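/- Let $n, d_1,\dots,d_n\ge 1$ be integers, and let $M$ be a complex matrix acting on $\mathbb{C}^{d_1}\otimes\cdots\otimes\mathbb{C}^{d_n}$. For $1\le i\le n$ let $M_i\in\mathbb{C}^{d_i\times d_i}$ be the partial trace of $M$ over all tensor factors except the $i$-th one. For $p\in[1,\infty]$ let $\|\cdot\|_p$ denote the Schatten $p$-norm, i.e. the $\ell_p$-norm of the vector of singular values (and $1/\infty:=0$). If $M$ has rank $r$, then for all $p\in[1,\infty]$ and all real $\gamma\ge 1$ $$\sum_{i=1}^n\|M_i\|_p^\gamma\;\le\;\Big(1+r^{\gamma(1-1/p)}(n-1)\Big)\|M\|_p^\gamma .$$ The inequality is tight whenever the rank does not exceed the largest local dimension: for every integer $0\le r\le\max_i d_i$ there is a matrix $M$ of rank $r$ on $\mathbb{C}^{d_1}\otimes\cdots\otimes\mathbb{C}^{d_n}$ for which equality holds for all $p\in[1,\infty]$ and all $\gamma\ge1$ simultaneously. -/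

import Mathlib

/-- The Schatten `p`-norm of a complex matrix, `p ∈ [1, ∞]`: the `ℓ^p`-norm of the vector of its
singular values (one for each column, with multiplicity, zeros included). -/
noncomputable def schattenNorm {m : Type*} [Fintype m] [DecidableEq m] (p : ENNReal)
    (A : Matrix m m ℂ) : ℝ :=
  ‖(WithLp.toLp p (fun k : Fin (Fintype.card m) => (Matrix.toEuclideanLin A).singularValues k) :
    PiLp p (fun _ : Fin (Fintype.card m) => ℝ))‖

/-- A complex matrix acting on `ℂ^{d 0} ⊗ ⋯ ⊗ ℂ^{d (n-1)}`, with rows and columns indexed by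
multi-indices (the product basis). -/
abbrev TensorMatrix {n : ℕ} (d : Fin n → ℕ) : Type :=
  Matrix ((i : Fin n) → Fin (d i)) ((i : Fin n) → Fin (d i)) ℂ

/-- The `i`-th partial trace (marginal): all tensor factors except the `i`-th are traced out.
The row multi-index `x` runs over all multi-indices with `i`-th entry `a`; the column multi-index
agrees with `x` outside position `i` and has `i`-th entry `b`. -/
def marginal {n : ℕ} {d : Fin n → ℕ} (M : TensorMatrix d) (i : Fin n) :
    Matrix (Fin (d i)) (Fin (d i)) ℂ :=
  Matrix.of fun a b => ∑ x : (j : Fin n) → Fin (d j) with x i = a, M x (Function.update x i b)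

/-! ### Marginals of nonnegative functions on a finite product. -/

open Finset

/-! The problem reduces to nonnegative functions on multi-indices. Take singular value
decompositions M = X diag(s) Yᴴ and M_i = U_i diag(t_i) V_iᴴ, and put U = ⊗ U_i, V = ⊗ V_i. The
entries of t_i are the diagonal entries of U_iᴴ M_i V_i, hence partial sums of diagonal entries of M
in rotated product bases. By AM-GM they are bounded by the i-th marginal of w = B s, where B
averages the squared moduli of the entries of Uᴴ X and Vᴴ Y (`le_marginalSum`). The same w serves
every i.

The matrix B is doubly stochastic, so ∑ w = ∑ s, and ‖w‖_p ≤ ‖s‖_p by Birkhoff. Audenaert's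
inequality for w (`sum_norm_marginalSum_le`), which is dual to ∑ x_i ≤ n - 1 + ∏ x_i on the unit
cube, gives ∑ ‖M_i‖_p ≤ (n - 1) ‖M‖_1 + ‖M‖_p. Convexity of the γ-th power (`sum_rpow_le_of_sum_le`)
and Hölder on the support of s (`sum_le_card_rpow_mul_norm`) finish the bound. -/

theorem sum_le_card_sub_one_add_prod {ι : Type*} (s : Finset ι) (x : ι → ℝ)
    (h0 : ∀ i, 0 ≤ x i) (h1 : ∀ i, x i ≤ 1) :
    ∑ i ∈ s, x i ≤ ((#s : ℝ) - 1) + ∏ i ∈ s, x i := by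
  classical
  induction s using Finset.induction_on with
  | empty => simp
  | insert a s ha ih =>
    rw [sum_insert ha, prod_insert ha, card_insert_of_notMem ha]
    have hP : ∏ i ∈ s, x i ≤ 1 := prod_le_one (fun i _ => h0 i) (fun i _ => h1 i)
    push_cast
    -- With P the product over `s`, the two sides differ by (1 - x a)(1 - P) once `ih` is added.
    nlinarith [mul_nonneg (sub_nonneg.2 (h1 a)) (sub_nonneg.2 hP)]

/-- The `i`-th marginal of a real function on a finite product. -/
def marginalSum {ι : Type*} [Fintype ι] [DecidableEq ι] {κ : ι → Type*} [∀ i, Fintype (κ i)]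
    [∀ i, DecidableEq (κ i)] (w : (∀ i, κ i) → ℝ) (i : ι) (a : κ i) : ℝ :=
  ∑ b : ∀ j, κ j with b i = a, w b

section
variable {ι : Type*} [Fintype ι] [DecidableEq ι] {κ : ι → Type*} [∀ i, Fintype (κ i)]
    [∀ i, DecidableEq (κ i)] {w : (∀ i, κ i) → ℝ}

theorem marginalSum_nonneg (hw : ∀ b, 0 ≤ w b) (i : ι) (a : κ i) : 0 ≤ marginalSum w i a :=
  sum_nonneg fun b _ => hw b

theorem sum_marginalSum_mul (w : (∀ i, κ i) → ℝ) (i : ι) (x : κ i → ℝ) :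
    ∑ a, marginalSum w i a * x a = ∑ b, w b * x (b i) := by
  rw [← sum_fiberwise univ (fun b : ∀ j, κ j => b i) (fun b => w b * x (b i))]
  refine sum_congr rfl fun a _ => ?_
  rw [marginalSum, sum_mul]
  refine sum_congr rfl fun b hb => ?_
  rw [(mem_filter.1 hb).2]

theorem sum_marginalSum (w : (∀ i, κ i) → ℝ) (i : ι) :
    ∑ a, marginalSum w i a = ∑ b, w b := by
  simpa using sum_marginalSum_mul w i (fun _ => 1)

/-- The scalar inequality averaged against `w`. With dual vectors of the marginals as `x i`, the
left side becomes a sum of norms and the last term pairs `w` with a product vector. -/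
theorem sum_pairing_marginalSum_le (hw : ∀ b, 0 ≤ w b) (x : ∀ i, κ i → ℝ)
    (h0 : ∀ i a, 0 ≤ x i a) (h1 : ∀ i a, x i a ≤ 1) :
    ∑ i, ∑ a, marginalSum w i a * x i a ≤
      ((Fintype.card ι : ℝ) - 1) * ∑ b, w b + ∑ b, w b * ∏ i, x i (b i) := by
  simp_rw [sum_marginalSum_mul]
  rw [sum_comm, mul_sum, ← sum_add_distrib]
  refine sum_le_sum fun b _ => ?_
  rw [← mul_sum]
  have := mul_le_mul_of_nonneg_left (sum_le_card_sub_one_add_prod univ (fun i => x i (b i))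
    (fun i => h0 i _) (fun i => h1 i _)) (hw b)
  rw [card_univ] at this
  linarith
end

/-! ### Finite ℓ^p norms and dual vectors. -/

theorem norm_toLp_eq_sum_rpow {ι : Type*} [Fintype ι] {p : ENNReal} (hp : 0 < p.toReal)
    {f : ι → ℝ} (hf : ∀ i, 0 ≤ f i) :
    ‖(WithLp.toLp p f : PiLp p fun _ : ι => ℝ)‖ = (∑ i, f i ^ p.toReal) ^ (1 / p.toReal) := by
  rw [PiLp.norm_eq_sum hp]
  simp [abs_of_nonneg (hf _)]

theorem norm_toLp_one {ι : Type*} [Fintype ι] {f : ι → ℝ} (hf : ∀ i, 0 ≤ f i) :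
    ‖(WithLp.toLp 1 f : PiLp 1 fun _ : ι => ℝ)‖ = ∑ i, f i := by
  rw [norm_toLp_eq_sum_rpow (by simp) hf]
  simp

theorem le_norm_toLp_top {ι : Type*} [Fintype ι] (f : ι → ℝ) (i : ι) :
    f i ≤ ‖(WithLp.toLp ⊤ f : PiLp ⊤ fun _ : ι => ℝ)‖ := by
  rw [PiLp.norm_eq_ciSup]
  exact (le_abs_self _).trans
    (le_ciSup (f := fun i => ‖f i‖) (Set.finite_range _).bddAbove i)

theorem norm_toLp_mono {ι : Type*} [Fintype ι] {p : ENNReal} (hp : 1 ≤ p) {f g : ι → ℝ}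
    (hf : ∀ i, 0 ≤ f i) (hfg : ∀ i, f i ≤ g i) :
    ‖(WithLp.toLp p f : PiLp p fun _ : ι => ℝ)‖ ≤ ‖(WithLp.toLp p g : PiLp p fun _ : ι => ℝ)‖ := by
  rcases eq_or_ne p ⊤ with rfl | ht
  · rw [PiLp.norm_eq_ciSup]
    refine Real.iSup_le (fun i => ?_) (norm_nonneg _)
    simp only [Real.norm_eq_abs, abs_of_nonneg (hf i)]
    exact (hfg i).trans (le_norm_toLp_top g i)
  · have hp0 : 0 < p.toReal := ENNReal.toReal_pos (by positivity) ht
    rw [norm_toLp_eq_sum_rpow hp0 hf, norm_toLp_eq_sum_rpow hp0 fun i => (hf i).trans (hfg i)]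
    have := hp0.le
    refine Real.rpow_le_rpow (sum_nonneg fun i _ => Real.rpow_nonneg (hf i) _) (sum_le_sum
      fun i _ => Real.rpow_le_rpow (hf i) (hfg i) hp0.le) (by positivity)

theorem norm_toLp_le_sum {ι : Type*} [Fintype ι] {p : ENNReal} (hp : 1 ≤ p) {f : ι → ℝ}
    (hf : ∀ i, 0 ≤ f i) :
    ‖(WithLp.toLp p f : PiLp p fun _ : ι => ℝ)‖ ≤ ∑ i, f i := by
  classical
  have : Fact (1 ≤ p) := ⟨hp⟩
  have h : (WithLp.toLp p f : PiLp p fun _ : ι => ℝ) = ∑ i, PiLp.single p i (f i) := by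
    ext j
    simp
  rw [h]
  refine (norm_sum_le _ _).trans (le_of_eq (sum_congr rfl fun i _ => ?_))
  rw [PiLp.norm_single, Real.norm_of_nonneg (hf i)]

/-- Equality case of Hölder. The entrywise bound by 1 follows from the ℓ^q bound and puts `x` in the
unit cube, where the scalar inequality applies. -/
theorem exists_nonneg_dual_vector {ι : Type*} [Fintype ι] {p q : ℝ} (hpq : p.HolderConjugate q)
    {f : ι → ℝ} (hf : ∀ i, 0 ≤ f i) :
    ∃ x : ι → ℝ, (∀ i, 0 ≤ x i) ∧ (∀ i, x i ≤ 1) ∧ ∑ i, x i ^ q ≤ 1 ∧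
      ∑ i, f i * x i = (∑ i, f i ^ p) ^ (1 / p) := by
  obtain ⟨x, hx, he⟩ := (NNReal.isGreatest_Lp univ (fun i => (⟨f i, hf i⟩ : NNReal)) hpq).1
  have hx' : ∑ i, (x i : ℝ) ^ q ≤ 1 := by exact_mod_cast hx
  refine ⟨fun i => x i, fun i => (x i).2, fun i => ?_, hx', ?_⟩
  · have h1 : (x i : ℝ) ^ q ≤ 1 := (single_le_sum
      (f := fun i => (x i : ℝ) ^ q) (fun j _ => Real.rpow_nonneg (x j).2 _) (mem_univ i)).trans hx'
    by_contra hc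
    exact h1.not_gt (Real.one_lt_rpow (not_le.1 hc) hpq.symm.pos)
  · have := congrArg (fun t : NNReal => (t : ℝ)) he
    push_cast at this
    exact this

/-! ### Subadditivity for marginals of nonnegative functions. -/

section
variable {ι : Type*} [Fintype ι] [DecidableEq ι] {κ : ι → Type*} [∀ i, Fintype (κ i)]
    [∀ i, DecidableEq (κ i)] {w : (∀ i, κ i) → ℝ}

/-- Audenaert's subadditivity inequality for the marginals of a nonnegative function. -/
theorem sum_norm_marginalSum_le {p : ENNReal} (hp : 1 ≤ p) (hw : ∀ b, 0 ≤ w b) :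
    ∑ i, ‖(WithLp.toLp p (marginalSum w i) : PiLp p fun _ : κ i => ℝ)‖ ≤
      ((Fintype.card ι : ℝ) - 1) * ∑ b, w b +
        ‖(WithLp.toLp p w : PiLp p fun _ : ∀ i, κ i => ℝ)‖ := by
  rcases eq_or_ne p ⊤ with rfl | ht
  · by_cases hne : ∀ i, Nonempty (κ i)
    · have hmax : ∀ i, ∃ a, ∀ c, marginalSum w i c ≤ marginalSum w i a := fun i =>
        Finite.exists_max _
      choose a ha using hmax
      -- For p = ∞ the dual vectors are the indicators of maximizers of the marginals.
      have key := sum_pairing_marginalSum_le hw (fun i => Pi.single (a i) 1)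
        (fun i c => by by_cases h : c = a i <;> simp [h])
        (fun i c => by by_cases h : c = a i <;> simp [h])
      have h1 : ∀ i, ‖(WithLp.toLp ⊤ (marginalSum w i) : PiLp ⊤ fun _ : κ i => ℝ)‖ ≤
          ∑ c, marginalSum w i c * (Pi.single (a i) 1 : κ i → ℝ) c := fun i => by
        simp only [Pi.single_apply, mul_ite, mul_one, mul_zero, sum_ite_eq', mem_univ, if_true]
        rw [PiLp.norm_eq_ciSup]
        refine Real.iSup_le (fun c => ?_) (marginalSum_nonneg hw _ _)
        simp only [Real.norm_eq_abs, abs_of_nonneg (marginalSum_nonneg hw i c)]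
        exact ha i c
      have h2 : ∑ b, w b * ∏ i, (Pi.single (a i) 1 : κ i → ℝ) (b i) = w a := by
        rw [sum_eq_single a]
        · simp
        · intro b _ hb
          obtain ⟨i, hi⟩ := Function.ne_iff.1 hb
          rw [prod_eq_zero (mem_univ i) (by simp [hi]), mul_zero]
        · simp
      rw [h2] at key
      exact (sum_le_sum fun i _ => h1 i).trans
        (key.trans (by gcongr; exact le_norm_toLp_top w a))
    · have : IsEmpty (∀ i, κ i) := by
        rw [← not_nonempty_iff]
        exact fun ⟨b⟩ => hne fun i => ⟨b i⟩
      have h0 : ∀ i, ‖(WithLp.toLp ⊤ (marginalSum w i) : PiLp ⊤ fun _ : κ i => ℝ)‖ ≤ 0 := fun i =>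
        (norm_toLp_le_sum le_top (marginalSum_nonneg hw i)).trans (by
          rw [sum_marginalSum]; simp)
      calc _ ≤ ∑ i : ι, (0 : ℝ) := sum_le_sum fun i _ => h0 i
        _ ≤ _ := by simp
  rcases hp.eq_or_lt with rfl | hp1
  · have key := sum_pairing_marginalSum_le hw (fun _ _ => 1) (by simp) (by simp)
    simp_rw [norm_toLp_one (marginalSum_nonneg hw _), norm_toLp_one hw]
    simpa using key
  · have hp1' : 1 < p.toReal := by
      rw [← ENNReal.toReal_one]
      exact (ENNReal.toReal_lt_toReal ENNReal.one_ne_top ht).2 hp1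
    have hp0 : 0 < p.toReal := by linarith
    have hpq := Real.HolderConjugate.conjExponent hp1'
    set q := p.toReal.conjExponent
    choose x h0 h1 hq hx using fun i => exists_nonneg_dual_vector hpq (marginalSum_nonneg hw i)
    have key := sum_pairing_marginalSum_le hw x h0 h1
    simp_rw [hx, ← norm_toLp_eq_sum_rpow hp0 (marginalSum_nonneg hw _)] at key
    refine key.trans ?_
    gcongr
    -- The q-norm is multiplicative on product vectors, so the product of the dual vectors is again
    -- admissible in Hölder.
    have hq' : ∑ b : ∀ i, κ i, (∏ i, x i (b i)) ^ q ≤ 1 := by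
      simp_rw [← Real.finsetProd_rpow univ _ (fun i _ => h0 i _)]
      rw [← Fintype.prod_sum fun i a => x i a ^ q]
      exact prod_le_one (fun i _ => sum_nonneg fun a _ => Real.rpow_nonneg (h0 i a) _)
        fun i _ => hq i
    have hy : ∀ b : ∀ i, κ i, 0 ≤ ∏ i, x i (b i) := fun b => prod_nonneg fun i _ => h0 i _
    have hH := Real.inner_le_Lp_mul_Lq_of_nonneg univ hpq (fun b _ => hw b) (fun b _ => hy b)
    rw [norm_toLp_eq_sum_rpow hp0 hw]
    refine hH.trans (mul_le_of_le_one_right ?_ ?_)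
    · exact Real.rpow_nonneg (sum_nonneg fun b _ => Real.rpow_nonneg (hw b) _) _
    · exact Real.rpow_le_one (sum_nonneg fun b _ => Real.rpow_nonneg (hy b) _) hq'
        (one_div_nonneg.2 hpq.symm.pos.le)
end

/-! ### Passing to the power γ, and Hölder on the support. -/

/-- The family `a` is weakly majorized by (A, …, A, B). If some entry is at most `B`, termwise
comparison suffices; otherwise all entries lie in (B, A], and the chord of t ↦ t ^ γ over [B, A]
bounds each term. -/
theorem sum_rpow_le_of_sum_le {n : ℕ} (hn : 0 < n) {a : Fin n → ℝ} {A B γ : ℝ} (hγ : 1 ≤ γ)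
    (h0 : ∀ i, 0 ≤ a i) (hA : ∀ i, a i ≤ A) (hB : 0 ≤ B) (hBA : B ≤ A)
    (hs : ∑ i, a i ≤ ((n : ℝ) - 1) * A + B) :
    ∑ i, a i ^ γ ≤ ((n : ℝ) - 1) * A ^ γ + B ^ γ := by
  have hγ0 : 0 ≤ γ := by linarith
  have hmono : ∀ i, a i ^ γ ≤ A ^ γ := fun i => Real.rpow_le_rpow (h0 i) (hA i) hγ0
  by_cases hj : ∃ j, a j ≤ B
  · obtain ⟨j, hj⟩ := hj
    rw [← sum_erase_add _ _ (mem_univ j)]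
    refine add_le_add ?_ (Real.rpow_le_rpow (h0 j) hj hγ0)
    refine (sum_le_card_nsmul _ _ _ fun i _ => hmono i).trans (le_of_eq ?_)
    rw [card_erase_of_mem (mem_univ j), card_univ, Fintype.card_fin, nsmul_eq_mul,
      Nat.cast_sub hn, Nat.cast_one]
  · push Not at hj
    have hBA' : B < A := (hj ⟨0, hn⟩).trans_le (hA _)
    have hd : 0 < A - B := by linarith
    have hm : B ^ γ ≤ A ^ γ := Real.rpow_le_rpow hB hBA hγ0
    have hc : ∀ i, (A - B) * a i ^ γ ≤ (A - a i) * B ^ γ + (a i - B) * A ^ γ := fun i => by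
      have := (convexOn_rpow hγ).2 (Set.mem_Ici.2 hB) (Set.mem_Ici.2 (hB.trans hBA))
        
        (div_nonneg (sub_nonneg.2 (hA i)) hd.le) (div_nonneg (sub_nonneg.2 (hj i).le) hd.le)
        (by field_simp; ring)
      have he : (A - a i) / (A - B) * B + (a i - B) / (A - B) * A = a i := by field_simp; ring
      simp only [smul_eq_mul] at this
      rw [he, ← mul_le_mul_iff_right₀ hd] at this
      refine this.trans (le_of_eq ?_)
      field_simp
    have hsum : (A - B) * ∑ i, a i ^ γ ≤
        (n * A - ∑ i, a i) * B ^ γ + (∑ i, a i - n * B) * A ^ γ := by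
      rw [mul_sum]
      refine (sum_le_sum fun i _ => hc i).trans (le_of_eq ?_)
      rw [sum_add_distrib, ← sum_mul, ← sum_mul, sum_sub_distrib, sum_sub_distrib]
      simp
    refine le_of_mul_le_mul_left (hsum.trans ?_) hd
    -- The chord bound is increasing in ∑ a i, and at the maximal value (n - 1) A + B it equals the
    -- claim times A - B.
    nlinarith [mul_nonneg (sub_nonneg.2 hs) (sub_nonneg.2 hm)]

theorem sum_le_card_rpow_mul_norm {ι : Type*} [Fintype ι] {p : ENNReal} (hp : 1 ≤ p) {f : ι → ℝ}
    (hf : ∀ i, 0 ≤ f i) :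
    ∑ i, f i ≤ ((#{i | f i ≠ 0} : ℕ) : ℝ) ^ (1 - (p⁻¹).toReal) *
      ‖(WithLp.toLp p f : PiLp p fun _ : ι => ℝ)‖ := by
  have hsupp : ∑ i, f i = ∑ i with f i ≠ 0, f i := (sum_filter_ne_zero _).symm
  rcases eq_or_ne p ⊤ with rfl | ht
  · rw [hsupp]
    refine (sum_le_card_nsmul _ _ _ fun i _ => le_norm_toLp_top f i).trans ?_
    simp
  rcases hp.eq_or_lt with rfl | hp1
  · simp [norm_toLp_one hf]
  · have hp1' : 1 < p.toReal := by
      rw [← ENNReal.toReal_one]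
      exact (ENNReal.toReal_lt_toReal ENNReal.one_ne_top ht).2 hp1
    have hp0 : 0 < p.toReal := by linarith
    have hpq := Real.HolderConjugate.conjExponent hp1'
    have hH := Real.inner_le_Lp_mul_Lq_of_nonneg {i | f i ≠ 0} hpq (f := f) (g := fun _ => 1)
      (fun i _ => hf i) (fun i _ => zero_le_one)
    rw [norm_toLp_eq_sum_rpow hp0 hf, hsupp, mul_comm]
    simp only [mul_one, Real.one_rpow, sum_const, nsmul_eq_mul] at hH
    have he : 1 - (p⁻¹).toReal = 1 / p.toReal.conjExponent := by
      rw [ENNReal.toReal_inv, one_div, ← hpq.one_sub_inv]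
    rw [he]
    refine hH.trans ?_
    gcongr
    · exact sum_nonneg fun i _ => Real.rpow_nonneg (hf i) _
    · exact fun i _ _ => Real.rpow_nonneg (hf i) _
    · exact subset_univ _

/-! ### Schatten norms, doubly stochastic matrices and singular values. -/

section
open Matrix
variable {m : Type*} [Fintype m] [DecidableEq m]

theorem schattenNorm_nonneg {p : ENNReal} (hp : 1 ≤ p) (A : Matrix m m ℂ) :
    0 ≤ schattenNorm p A := by
  have : Fact (1 ≤ p) := ⟨hp⟩
  exact norm_nonneg _

theorem norm_toLp_comp_equiv {ι ι' : Type*} [Fintype ι] [Fintype ι'] {p : ENNReal} (hp : 1 ≤ p)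
    (e : ι ≃ ι') (f : ι' → ℝ) :
    ‖(WithLp.toLp p (fun i => f (e i)) : PiLp p fun _ : ι => ℝ)‖ =
      ‖(WithLp.toLp p f : PiLp p fun _ : ι' => ℝ)‖ := by
  have : Fact (1 ≤ p) := ⟨hp⟩
  exact (LinearIsometryEquiv.piLpCongrLeft p ℝ ℝ e.symm).norm_map (WithLp.toLp p f)

/-- By Birkhoff, `B` is a convex combination of permutations, each of which preserves the norm. -/
theorem norm_toLp_mulVec_le_of_mem_doublyStochastic {p : ENNReal} (hp : 1 ≤ p)
    {B : Matrix m m ℝ} (hB : B ∈ doublyStochastic ℝ m) (s : m → ℝ) :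
    ‖(WithLp.toLp p (B *ᵥ s) : PiLp p fun _ : m => ℝ)‖ ≤
      ‖(WithLp.toLp p s : PiLp p fun _ : m => ℝ)‖ := by
  have : Fact (1 ≤ p) := ⟨hp⟩
  obtain ⟨w, hw0, hw1, rfl⟩ := exists_eq_sum_perm_of_mem_doublyStochastic hB
  have h : (WithLp.toLp p ((∑ σ : Equiv.Perm m, w σ • σ.permMatrix ℝ) *ᵥ s) :
      PiLp p fun _ : m => ℝ) = ∑ σ : Equiv.Perm m, w σ • WithLp.toLp p (fun i => s (σ i)) := by
    rw [Matrix.sum_mulVec, WithLp.toLp_sum]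
    refine sum_congr rfl fun σ _ => ?_
    rw [Matrix.smul_mulVec, Matrix.permMatrix_mulVec]
    rfl
  rw [h]
  refine (norm_sum_le _ _).trans (le_of_eq ?_)
  simp_rw [norm_smul, norm_toLp_comp_equiv hp, Real.norm_of_nonneg (hw0 _)]
  rw [← sum_mul, hw1, one_mul]

theorem normSq_mem_doublyStochastic {U : Matrix m m ℂ} (hU : U ∈ unitaryGroup m ℂ) :
    (Matrix.of fun i j => ‖U i j‖ ^ 2) ∈ doublyStochastic ℝ m := by
  refine mem_doublyStochastic_iff_sum.2 ⟨fun i j => by simp, fun i => ?_, fun j => ?_⟩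
  · have h := congrFun (congrFun (mem_unitaryGroup_iff.1 hU) i) i
    rw [Matrix.mul_apply] at h
    simp only [star_apply, one_apply_eq, RCLike.star_def, Complex.mul_conj'] at h
    exact_mod_cast h
  · have h := congrFun (congrFun (mem_unitaryGroup_iff'.1 hU) j) j
    rw [Matrix.mul_apply] at h
    simp only [star_apply, one_apply_eq, RCLike.star_def, Complex.conj_mul'] at h
    exact_mod_cast h

/-- The average of the doubly stochastic matrices attached to two matrices. -/
noncomputable def averageNormSq (X Y : Matrix m m ℂ) : Matrix m m ℝ :=
  Matrix.of fun i j => (‖X i j‖ ^ 2 + ‖Y i j‖ ^ 2) / 2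

theorem averageNormSq_mem_doublyStochastic {X Y : Matrix m m ℂ} (hX : X ∈ unitaryGroup m ℂ)
    (hY : Y ∈ unitaryGroup m ℂ) : averageNormSq X Y ∈ doublyStochastic ℝ m := by
  have := convex_doublyStochastic (normSq_mem_doublyStochastic hX) (normSq_mem_doublyStochastic hY)
    (a := 1 / 2) (b := 1 / 2) (by norm_num) (by norm_num) (by norm_num)
  have he : averageNormSq X Y = (1 / 2 : ℝ) • (Matrix.of fun i j => ‖X i j‖ ^ 2) +
      (1 / 2 : ℝ) • (Matrix.of fun i j => ‖Y i j‖ ^ 2) := by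
    ext i j
    simp [averageNormSq]
    ring
  rw [he]
  exact this

theorem mul_diagonal_mul_conjTranspose_apply (X Y : Matrix m m ℂ) (s : m → ℂ) (i j : m) :
    (X * diagonal s * Yᴴ) i j = ∑ k, X i k * s k * star (Y j k) := by
  rw [Matrix.mul_apply]
  simp only [Matrix.mul_diagonal, conjTranspose_apply]

/-- AM-GM on ‖X i k‖ ‖Y i k‖. Averaging is needed because the left and right singular bases differ
in general. -/
theorem norm_diag_le (X Y : Matrix m m ℂ) {s : m → ℝ} (hs : ∀ i, 0 ≤ s i) (i : m) :
    ‖(X * diagonal (fun k => (s k : ℂ)) * Yᴴ) i i‖ ≤ (averageNormSq X Y *ᵥ s) i := by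
  rw [mul_diagonal_mul_conjTranspose_apply]
  refine (norm_sum_le _ _).trans (sum_le_sum fun k _ => ?_)
  rw [norm_mul, norm_mul, norm_star, Complex.norm_real, Real.norm_of_nonneg (hs k)]
  simp only [averageNormSq, of_apply]
  nlinarith [mul_nonneg (sq_nonneg (‖X i k‖ - ‖Y i k‖)) (hs k)]

theorem diag_eq (X : Matrix m m ℂ) (s : m → ℝ) (i : m) :
    (X * diagonal (fun k => (s k : ℂ)) * Xᴴ) i i = ((∑ k, ‖X i k‖ ^ 2 * s k : ℝ) : ℂ) := by
  rw [mul_diagonal_mul_conjTranspose_apply]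
  push_cast
  refine sum_congr rfl fun k _ => ?_
  rw [mul_right_comm, RCLike.star_def, Complex.mul_conj']

/-- Solving for diag(s) and reading off its diagonal bounds `s` by a doubly stochastic image of
`s'`. Used in both directions, it makes the norm independent of the chosen decomposition. -/
theorem norm_toLp_le_of_mul_diagonal_eq {p : ENNReal} (hp : 1 ≤ p) {U V U' V' : Matrix m m ℂ}
    (hU : U ∈ unitaryGroup m ℂ) (hV : V ∈ unitaryGroup m ℂ) (hU' : U' ∈ unitaryGroup m ℂ)
    (hV' : V' ∈ unitaryGroup m ℂ) {s s' : m → ℝ} (hs : ∀ i, 0 ≤ s i) (hs' : ∀ i, 0 ≤ s' i)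
    (h : U * diagonal (fun k => (s k : ℂ)) * Vᴴ = U' * diagonal (fun k => (s' k : ℂ)) * V'ᴴ) :
    ‖(WithLp.toLp p s : PiLp p fun _ : m => ℝ)‖ ≤
      ‖(WithLp.toLp p s' : PiLp p fun _ : m => ℝ)‖ := by
  have hUU : Uᴴ * U = 1 := mem_unitaryGroup_iff'.1 hU
  have hVV : Vᴴ * V = 1 := mem_unitaryGroup_iff'.1 hV
  have hX : Uᴴ * U' ∈ unitaryGroup m ℂ := mul_mem (Unitary.star_mem hU) hU'
  have hY : Vᴴ * V' ∈ unitaryGroup m ℂ := mul_mem (Unitary.star_mem hV) hV'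
  have he : diagonal (fun k => (s k : ℂ)) =
      (Uᴴ * U') * diagonal (fun k => (s' k : ℂ)) * (Vᴴ * V')ᴴ := by
    rw [conjTranspose_mul, conjTranspose_conjTranspose]
    calc _ = (Uᴴ * U) * diagonal (fun k => (s k : ℂ)) * (Vᴴ * V) := by rw [hUU, hVV]; simp
      _ = Uᴴ * (U * diagonal (fun k => (s k : ℂ)) * Vᴴ) * V := by simp only [Matrix.mul_assoc]
      _ = _ := by rw [h]; simp only [Matrix.mul_assoc]
  refine (norm_toLp_mono hp hs fun i => ?_).trans
    (norm_toLp_mulVec_le_of_mem_doublyStochastic hp (averageNormSq_mem_doublyStochastic hX hY) s')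
  have := norm_diag_le (Uᴴ * U') (Vᴴ * V') hs' i
  rw [← he, diagonal_apply_eq, Complex.norm_real, Real.norm_of_nonneg (hs i)] at this
  exact this

theorem orthonormalBasis_mem_unitaryGroup (b : OrthonormalBasis m ℂ (EuclideanSpace ℂ m)) :
    (Matrix.of fun i k => b k i) ∈ unitaryGroup m ℂ := by
  rw [mem_unitaryGroup_iff']
  ext k l
  have h := orthonormal_iff_ite.1 b.orthonormal k l
  rw [Matrix.mul_apply, one_apply, ← h, PiLp.inner_apply]
  refine sum_congr rfl fun i _ => ?_
  simp [mul_comm]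

/-- The singular value decomposition. -/
theorem exists_svd (A : Matrix m m ℂ) :
    ∃ U ∈ unitaryGroup m ℂ, ∃ V ∈ unitaryGroup m ℂ, ∃ s : m → ℝ, (∀ i, 0 ≤ s i) ∧
      A = U * diagonal (fun k => (s k : ℂ)) * Vᴴ ∧
      ∀ p : ENNReal, 1 ≤ p → schattenNorm p A = ‖(WithLp.toLp p s : PiLp p fun _ : m => ℝ)‖ := by
  set T := Matrix.toEuclideanLin A with hT
  have hn : Module.finrank ℂ (EuclideanSpace ℂ m) = Fintype.card m := finrank_euclideanSpace
  let e : m ≃ Fin (Fintype.card m) := Fintype.equivFin m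
  let v := (T.isSymmetric_adjoint_comp_self.eigenvectorBasis hn).reindex e.symm
  let s : m → ℝ := fun k => T.singularValues (e k)
  have hs : ∀ k, 0 ≤ s k := fun k => T.singularValues_nonneg _
  have hv : ∀ k, LinearMap.adjoint T (T (v k)) = ((s k : ℂ) ^ 2) • v k := fun k => by
    have h := T.isSymmetric_adjoint_comp_self.apply_eigenvectorBasis hn (e k)
    rw [← T.sq_singularValues_fin hn] at h
    simp only [v, s, OrthonormalBasis.reindex_apply, Equiv.symm_symm]
    refine h.trans ?_
    simp
  have hin : ∀ k l, inner ℂ (T (v k)) (T (v l)) = if k = l then (s l : ℂ) ^ 2 else 0 := by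
    intro k l
    rw [← LinearMap.adjoint_inner_right, hv, inner_smul_right,
      orthonormal_iff_ite.1 v.orthonormal]
    simp
  -- Left singular vectors: the normalized images for nonzero singular values, to be completed to an
  -- orthonormal basis.
  have hor : Orthonormal ℂ (Set.domRestrict {k | s k ≠ 0} fun k => ((s k : ℂ)⁻¹) • T (v k)) := by
    rw [orthonormal_iff_ite]
    rintro ⟨k, hk⟩ ⟨l, hl⟩
    have hl' : (s l : ℂ) ≠ 0 := by exact_mod_cast hl
    simp only [Set.domRestrict_apply, inner_smul_left, inner_smul_right, hin, Subtype.mk.injEq]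
    split_ifs with h
    · subst h
      simp
      field_simp
    · simp
  obtain ⟨u, hu⟩ := hor.exists_orthonormalBasis_extension_of_card_eq hn
  have hTv : ∀ k, T (v k) = (s k : ℂ) • u k := fun k => by
    by_cases hk : s k = 0
    · have := hin k k
      rw [if_pos rfl, hk] at this
      rw [hk, inner_self_eq_zero.1 (this.trans (by simp))]
      simp
    · have hk' : (s k : ℂ) ≠ 0 := by exact_mod_cast hk
      rw [hu k hk, smul_smul, mul_inv_cancel₀ hk', one_smul]
  have hV := orthonormalBasis_mem_unitaryGroup v
  refine ⟨_, orthonormalBasis_mem_unitaryGroup u, _, hV, s, hs, ?_, fun p hp => ?_⟩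
  · have hAV : A * (Matrix.of fun i k => v k i) =
        (Matrix.of fun i k => u k i) * diagonal (fun k => (s k : ℂ)) := by
      ext i k
      have := congrArg (fun x : EuclideanSpace ℂ m => x i) (hTv k)
      rw [Matrix.mul_diagonal, Matrix.mul_apply]
      simpa [hT, Matrix.toLpLin_apply, Matrix.mulVec, dotProduct, mul_comm] using this
    rw [← hAV, Matrix.mul_assoc]
    have h1 : (Matrix.of fun i k => v k i) * (Matrix.of fun i k => v k i)ᴴ = 1 :=
      mem_unitaryGroup_iff.1 hV
    rw [h1, Matrix.mul_one]
  · exact (norm_toLp_comp_equiv hp e fun k => T.singularValues k).symm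

theorem schattenNorm_eq_of_svd {p : ENNReal} (hp : 1 ≤ p) {U V : Matrix m m ℂ}
    (hU : U ∈ unitaryGroup m ℂ) (hV : V ∈ unitaryGroup m ℂ) {s : m → ℝ} (hs : ∀ i, 0 ≤ s i) :
    schattenNorm p (U * diagonal (fun k => (s k : ℂ)) * Vᴴ) =
      ‖(WithLp.toLp p s : PiLp p fun _ : m => ℝ)‖ := by
  obtain ⟨U', hU', V', hV', s', hs', h, hn⟩ :=
    exists_svd (U * diagonal (fun k => (s k : ℂ)) * Vᴴ)
  rw [hn p hp]
  exact le_antisymm (norm_toLp_le_of_mul_diagonal_eq hp hU' hV' hU hV hs' hs h.symm)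
    (norm_toLp_le_of_mul_diagonal_eq hp hU hV hU' hV' hs hs' h)

theorem schattenNorm_diagonal {p : ENNReal} (hp : 1 ≤ p) {s : m → ℝ} (hs : ∀ i, 0 ≤ s i) :
    schattenNorm p (diagonal fun k => (s k : ℂ)) =
      ‖(WithLp.toLp p s : PiLp p fun _ : m => ℝ)‖ := by
  simpa using schattenNorm_eq_of_svd hp (one_mem (unitaryGroup m ℂ)) (one_mem _) hs

theorem rank_eq_of_svd {U V : Matrix m m ℂ} (hU : U ∈ unitaryGroup m ℂ)
    (hV : V ∈ unitaryGroup m ℂ) (s : m → ℝ) :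
    (U * diagonal (fun k => (s k : ℂ)) * Vᴴ).rank = #{i | s i ≠ 0} := by
  have h1 : IsUnit (Vᴴ).det := UnitaryGroup.det_isUnit ⟨Vᴴ, Unitary.star_mem hV⟩
  have h2 : IsUnit U.det := UnitaryGroup.det_isUnit ⟨U, hU⟩
  rw [rank_mul_eq_left_of_isUnit_det _ _ h1, rank_mul_eq_right_of_isUnit_det _ _ h2,
    rank_diagonal, Fintype.card_subtype]
  simp
end

/-! ### Local unitaries and partial traces. -/

section
open Matrix
variable {n : ℕ} {d : Fin n → ℕ}

/-- The tensor product of a family of square matrices. -/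
def tensorFamily (A : ∀ i, Matrix (Fin (d i)) (Fin (d i)) ℂ) : TensorMatrix d :=
  Matrix.of fun x y => ∏ i, A i (x i) (y i)

theorem tensorFamily_mem_unitaryGroup {A : ∀ i, Matrix (Fin (d i)) (Fin (d i)) ℂ}
    (hA : ∀ i, A i ∈ unitaryGroup (Fin (d i)) ℂ) :
    tensorFamily A ∈ unitaryGroup (∀ i, Fin (d i)) ℂ := by
  rw [mem_unitaryGroup_iff]
  ext x y
  have h : ∀ i, ∑ t, A i (x i) t * star (A i (y i) t) = if x i = y i then 1 else 0 := fun i => by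
    have := congrFun (congrFun (mem_unitaryGroup_iff.1 (hA i)) (x i)) (y i)
    rw [Matrix.mul_apply, Matrix.one_apply] at this
    exact this
  rw [Matrix.mul_apply, Matrix.one_apply]
  simp only [star_apply, tensorFamily, of_apply, star_prod, ← prod_mul_distrib]
  rw [← Fintype.prod_sum fun i t => A i (x i) t * star (A i (y i) t)]
  simp only [h]
  by_cases hxy : x = y
  · simp [hxy]
  · obtain ⟨i, hi⟩ := Function.ne_iff.1 hxy
    rw [if_neg hxy, prod_eq_zero (mem_univ i) (by simp [hi])]

/-- The sum factors over the tensor positions. Each traced factor gives a Kronecker delta by `h`,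
and only the i-th factor survives. -/
theorem sum_tensorFamily_mul {A B : ∀ i, Matrix (Fin (d i)) (Fin (d i)) ℂ} {i : Fin n}
    (h : ∀ j, j ≠ i → B j * (A j)ᴴ = 1) (y z : ∀ j, Fin (d j)) (a b : Fin (d i)) :
    ∑ x : (∀ j, Fin (d j)) with x i = a,
      star (tensorFamily A y x) * tensorFamily B z (Function.update x i b) =
    if z = Function.update y i (z i) then star (A i (y i) a) * B i (z i) b else 0 := by
  -- The constraint x i = a is absorbed into the i-th factor, so that the sum over all `x` becomes a
  -- product of sums.
  have h2 : ∀ x : ∀ j, Fin (d j),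
      (if x i = a then star (tensorFamily A y x) * tensorFamily B z (Function.update x i b) else 0)
      = ∏ j, Function.update (fun j t => star (A j (y j) t) * B j (z j) t) i
        (fun t => if t = a then star (A i (y i) a) * B i (z i) b else 0) j (x j) := fun x => by
    rw [← mul_prod_erase _ _ (mem_univ i)]
    simp only [Function.update_self, tensorFamily, of_apply, star_prod]
    split_ifs with hx
    · rw [← mul_prod_erase _ (fun j => star (A j (y j) (x j))) (mem_univ i),
        ← mul_prod_erase _ (fun j => B j (z j) (Function.update x i b j)) (mem_univ i),
        mul_mul_mul_comm, ← prod_mul_distrib, hx, Function.update_self]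
      congr 1
      refine prod_congr rfl fun j hj => ?_
      rw [Function.update_of_ne (ne_of_mem_erase hj), Function.update_of_ne (ne_of_mem_erase hj)]
    · simp
  rw [sum_filter]
  simp_rw [h2]
  rw [← Fintype.prod_sum fun j t => Function.update (fun j t => star (A j (y j) t) * B j (z j) t) i
        (fun t => if t = a then star (A i (y i) a) * B i (z i) b else 0) j t,
    ← mul_prod_erase _ _ (mem_univ i)]
  simp only [Function.update_self, sum_ite_eq', mem_univ, if_true]
  have h3 : ∀ j ∈ univ.erase i, ∑ t, Function.update (fun j t => star (A j (y j) t) * B j (z j) t) i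
      (fun t => if t = a then star (A i (y i) a) * B i (z i) b else 0) j t =
      if z j = y j then 1 else 0 := fun j hj => by
    have := congrFun (congrFun (h j (ne_of_mem_erase hj)) (z j)) (y j)
    rw [Matrix.mul_apply, Matrix.one_apply] at this
    rw [← this, Function.update_of_ne (ne_of_mem_erase hj)]
    exact sum_congr rfl fun t _ => mul_comm _ _
  rw [prod_congr rfl h3]
  split_ifs with hz
  · rw [prod_eq_one, mul_one]
    intro j hj
    rw [if_pos]
    rw [hz, Function.update_of_ne (ne_of_mem_erase hj)]
  · have : ∃ j, j ≠ i ∧ z j ≠ y j := by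
      by_contra! hc
      refine hz (funext fun j => ?_)
      by_cases hj : j = i
      · subst hj; simp
      · rw [Function.update_of_ne hj, hc j hj]
    obtain ⟨j, hj, hjz⟩ := this
    rw [prod_eq_zero (mem_erase.2 ⟨hj, mem_univ j⟩) (if_neg hjz), mul_zero]

/-- Partial traces are covariant under local operations which are inverse to each other on the
factors that are traced out. -/
theorem marginal_conjTranspose_mul_mul {A B : ∀ i, Matrix (Fin (d i)) (Fin (d i)) ℂ} {i : Fin n}
    (h : ∀ j, j ≠ i → B j * (A j)ᴴ = 1) (M : TensorMatrix d) :
    marginal ((tensorFamily A)ᴴ * M * tensorFamily B) i = (A i)ᴴ * marginal M i * B i := by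
  ext a b
  have hL : marginal ((tensorFamily A)ᴴ * M * tensorFamily B) i a b =
      ∑ y, ∑ z, M y z *
        if z = Function.update y i (z i) then star (A i (y i) a) * B i (z i) b else 0 := by
    simp_rw [← sum_tensorFamily_mul h, mul_sum]
    simp only [marginal, of_apply, Matrix.mul_apply, conjTranspose_apply, sum_mul]
    rw [sum_comm, sum_comm]
    simp_rw [sum_comm (s := univ.filter _)]
    rw [sum_comm]
    refine sum_congr rfl fun y _ => sum_congr rfl fun z _ => sum_congr rfl fun x _ => ?_
    ring
  have hR : ((A i)ᴴ * marginal M i * B i) a b =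
      ∑ y, ∑ t, M y (Function.update y i t) * (star (A i (y i) a) * B i t b) := by
    simp only [marginal, Matrix.mul_apply, conjTranspose_apply, of_apply, sum_mul, mul_sum]
    rw [sum_comm]
    rw [← sum_fiberwise univ (fun y : ∀ j, Fin (d j) => y i)]
    refine sum_congr rfl fun c _ => ?_
    rw [sum_comm]
    refine sum_congr rfl fun y hy => sum_congr rfl fun t _ => ?_
    rw [(mem_filter.1 hy).2]
    ring
  rw [hL, hR]
  refine sum_congr rfl fun y _ => ?_
  simp only [mul_ite, mul_zero]
  rw [← sum_filter]
  refine sum_bij' (fun z _ => z i) (fun t _ => Function.update y i t) (by simp) (by simp)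
    (fun z hz => (mem_filter.1 hz).2.symm) (by simp) fun z hz => ?_
  rw [← (mem_filter.1 hz).2]

theorem marginal_apply_self (M : TensorMatrix d) (i : Fin n) (a : Fin (d i)) :
    marginal M i a a = ∑ b : (∀ j, Fin (d j)) with b i = a, M b b := by
  simp only [marginal, of_apply]
  refine sum_congr rfl fun b hb => ?_
  rw [← (mem_filter.1 hb).2, Function.update_eq_self]

theorem update_mul_conjTranspose_eq_one {U V : ∀ i, Matrix (Fin (d i)) (Fin (d i)) ℂ}
    (hU : ∀ i, U i ∈ unitaryGroup _ ℂ) (i j : Fin n) (hj : j ≠ i) :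
    Function.update U i (V i) j * (U j)ᴴ = 1 := by
  rw [Function.update_of_ne hj]
  exact mem_unitaryGroup_iff.1 (hU j)

/-- By covariance the right side involves `W` only through `W i`: local unitaries on the traced
factors leave this marginal unchanged. -/
theorem marginalSum_diag_eq (W : ∀ i, Matrix (Fin (d i)) (Fin (d i)) ℂ)
    (hW : ∀ i, W i ∈ unitaryGroup _ ℂ) (V : TensorMatrix d) (s : (∀ i, Fin (d i)) → ℝ)
    (i : Fin n) (a : Fin (d i)) :
    ((marginalSum (fun b => ∑ k, ‖((tensorFamily W)ᴴ * V) b k‖ ^ 2 * s k) i a : ℝ) : ℂ) =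
      ((W i)ᴴ * marginal (V * diagonal (fun k => (s k : ℂ)) * Vᴴ) i * W i) a a := by
  rw [← marginal_conjTranspose_mul_mul (A := W) (B := W)
    (fun j _ => mem_unitaryGroup_iff.1 (hW j)), marginal_apply_self, marginalSum]
  push_cast
  refine sum_congr rfl fun b _ => ?_
  have := diag_eq ((tensorFamily W)ᴴ * V) s b
  push_cast at this
  rw [← this, conjTranspose_mul, conjTranspose_conjTranspose]
  simp only [Matrix.mul_assoc]

theorem le_marginalSum {U V : ∀ i, Matrix (Fin (d i)) (Fin (d i)) ℂ}
    (hU : ∀ i, U i ∈ unitaryGroup _ ℂ) (hV : ∀ i, V i ∈ unitaryGroup _ ℂ)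
    (X Y : TensorMatrix d) {s : (∀ i, Fin (d i)) → ℝ} (hs : ∀ b, 0 ≤ s b)
    (i : Fin n) {t : Fin (d i) → ℝ} (ht : ∀ a, 0 ≤ t a)
    (h : marginal (X * diagonal (fun k => (s k : ℂ)) * Yᴴ) i =
      U i * diagonal (fun k => (t k : ℂ)) * (V i)ᴴ) (a : Fin (d i)) :
    t a ≤ marginalSum (averageNormSq ((tensorFamily U)ᴴ * X) ((tensorFamily V)ᴴ * Y) *ᵥ s) i a := by
  -- Covariance needs the left and right unitaries to agree off position i, while diagonalizing the
  -- marginal needs `V i` on the right at i. The hybrid `W` meets both demands.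
  set W := Function.update U i (V i) with hWdef
  have hW : ∀ j, W j ∈ unitaryGroup _ ℂ := fun j => by
    by_cases hj : j = i
    · subst hj; simpa [W] using hV j
    · simpa [W, hj] using hU j
  have hWi : W i = V i := by simp [W]
  have hUU : (U i)ᴴ * U i = 1 := mem_unitaryGroup_iff'.1 (hU i)
  have hVV : (V i)ᴴ * V i = 1 := mem_unitaryGroup_iff'.1 (hV i)
  have hta : (t a : ℂ) = ∑ b : (∀ j, Fin (d j)) with b i = a,
      (((tensorFamily U)ᴴ * X) * diagonal (fun k => (s k : ℂ)) * ((tensorFamily W)ᴴ * Y)ᴴ) b b := by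
    calc (t a : ℂ) = ((U i)ᴴ * (U i * diagonal (fun k => (t k : ℂ)) * (V i)ᴴ) * V i) a a := by
          rw [← Matrix.mul_assoc, ← Matrix.mul_assoc, hUU, Matrix.mul_assoc, hVV]
          simp
      _ = marginal ((tensorFamily U)ᴴ * (X * diagonal (fun k => (s k : ℂ)) * Yᴴ) *
            tensorFamily W) i a a := by
          rw [← h, marginal_conjTranspose_mul_mul (update_mul_conjTranspose_eq_one hU i), ← hWdef, hWi]
      _ = _ := by
          rw [marginal_apply_self, conjTranspose_mul, conjTranspose_conjTranspose]
          simp only [Matrix.mul_assoc]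
  have hb : t a ≤ marginalSum
      (averageNormSq ((tensorFamily U)ᴴ * X) ((tensorFamily W)ᴴ * Y) *ᵥ s) i a := by
    rw [← Real.norm_of_nonneg (ht a), ← Complex.norm_real, hta]
    exact (norm_sum_le _ _).trans (sum_le_sum fun b _ => norm_diag_le _ _ hs b)
  -- Since `W i = V i`, the hybrid can be replaced by `V`, which removes the dependence of the
  -- bounding function on i.
  have hVW : marginalSum (fun b => ∑ k, ‖((tensorFamily W)ᴴ * Y) b k‖ ^ 2 * s k) i a =
      marginalSum (fun b => ∑ k, ‖((tensorFamily V)ᴴ * Y) b k‖ ^ 2 * s k) i a := by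
    have : ((marginalSum (fun b => ∑ k, ‖((tensorFamily W)ᴴ * Y) b k‖ ^ 2 * s k) i a : ℝ) : ℂ) =
        ((marginalSum (fun b => ∑ k, ‖((tensorFamily V)ᴴ * Y) b k‖ ^ 2 * s k) i a : ℝ) : ℂ) := by
      rw [marginalSum_diag_eq W hW, marginalSum_diag_eq V hV, hWi]
    exact_mod_cast this
  have hsplit : ∀ P Q : TensorMatrix d, marginalSum (averageNormSq P Q *ᵥ s) i a =
      (marginalSum (fun b => ∑ k, ‖P b k‖ ^ 2 * s k) i a +
        marginalSum (fun b => ∑ k, ‖Q b k‖ ^ 2 * s k) i a) / 2 := fun P Q => by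
    simp only [marginalSum, averageNormSq, Matrix.mulVec, dotProduct, of_apply]
    rw [← sum_add_distrib, sum_div]
    refine sum_congr rfl fun b _ => ?_
    rw [← sum_add_distrib, sum_div]
    refine sum_congr rfl fun k _ => ?_
    ring
  rwa [hsplit, hVW, ← hsplit] at hb
end

/-! ### The inequality. -/

/-- Every matrix satisfies the Schatten norm inequality for its marginals. -/
theorem sum_schattenNorm_marginal_rpow_le {n : ℕ} {d : Fin n → ℕ} (M : TensorMatrix d)
    {p : ENNReal} {γ : ℝ} (hp : 1 ≤ p) (hγ : 1 ≤ γ) :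
    ∑ i, schattenNorm p (marginal M i) ^ γ ≤
      (1 + (M.rank : ℝ) ^ (γ * (1 - (p⁻¹).toReal)) * ((n : ℝ) - 1)) * schattenNorm p M ^ γ := by
  have hγ0 : 0 < γ := by linarith
  have hM0 : 0 ≤ schattenNorm p M := schattenNorm_nonneg hp M
  obtain ⟨X, hX, Y, hY, s, hs, hM, hMn⟩ := exists_svd M
  choose U hU V hV t ht hm hmn using fun i => exists_svd (marginal M i)
  have hrank : M.rank = #{b | s b ≠ 0} := by
    rw [hM]; exact rank_eq_of_svd hX hY s
  rcases Nat.eq_zero_or_pos n with rfl | hn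
  -- For n = 0 the space is one-dimensional, so the coefficient 1 - r ^ (…) is nonnegative.
  · have h1 : M.rank ≤ 1 := by simpa using M.rank_le_card_width
    have hB : 0 ≤ schattenNorm p M ^ γ := Real.rpow_nonneg hM0 _
    simp only [univ_eq_empty, sum_empty]
    refine mul_nonneg ?_ hB
    have hp1 : (p⁻¹).toReal ≤ 1 := by
      simpa using ENNReal.toReal_mono ENNReal.one_ne_top (ENNReal.inv_le_one.2 hp)
    have := Real.rpow_le_one (x := M.rank) (Nat.cast_nonneg _) (by exact_mod_cast h1)
      (mul_nonneg hγ0.le (sub_nonneg.2 hp1))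
    push_cast
    linarith
  set B := averageNormSq ((tensorFamily U).conjTranspose * X) ((tensorFamily V).conjTranspose * Y)
  have hB : B ∈ doublyStochastic ℝ (∀ i, Fin (d i)) :=
    averageNormSq_mem_doublyStochastic
      (mul_mem (Unitary.star_mem (tensorFamily_mem_unitaryGroup hU)) hX)
      (mul_mem (Unitary.star_mem (tensorFamily_mem_unitaryGroup hV)) hY)
  set w := B.mulVec s
  have hw : ∀ b, 0 ≤ w b := fun b =>
    sum_nonneg fun k _ => mul_nonneg (nonneg_of_mem_doublyStochastic hB) (hs k)
  have hwsum : ∑ b, w b = ∑ b, s b := by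
    simp only [w, Matrix.mulVec, dotProduct]
    rw [sum_comm]
    simp_rw [← sum_mul, sum_col_of_mem_doublyStochastic hB, one_mul]
  have htw : ∀ i a, t i a ≤ marginalSum w i a := fun i a =>
    le_marginalSum hU hV X Y hs i (ht i) (by rw [← hM]; exact hm i) a
  have hle : ∀ i, schattenNorm p (marginal M i) ≤
      ‖(WithLp.toLp p (marginalSum w i) : PiLp p fun _ : Fin (d i) => ℝ)‖ := fun i => by
    rw [hmn i p hp]
    exact norm_toLp_mono hp (ht i) (htw i)
  have hs0 : ∀ i, 0 ≤ schattenNorm p (marginal M i) := fun i =>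
    schattenNorm_nonneg hp _
  have hA : ∀ i, schattenNorm p (marginal M i) ≤ ∑ b, s b := fun i => by
    refine (hle i).trans ((norm_toLp_le_sum hp (marginalSum_nonneg hw i)).trans (le_of_eq ?_))
    exact (sum_marginalSum w i).trans hwsum
  have hsum : ∑ i, schattenNorm p (marginal M i) ≤
      ((n : ℝ) - 1) * ∑ b, s b + schattenNorm p M := by
    refine (sum_le_sum fun i _ => hle i).trans ((sum_norm_marginalSum_le hp hw).trans ?_)
    rw [hwsum, Fintype.card_fin, hMn p hp]
    gcongr
    exact norm_toLp_mulVec_le_of_mem_doublyStochastic hp hB s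
  refine (sum_rpow_le_of_sum_le hn hγ hs0 hA hM0
    (by rw [hMn p hp]; exact norm_toLp_le_sum hp hs) hsum).trans ?_
  have hr : (∑ b, s b) ^ γ ≤
      (M.rank : ℝ) ^ (γ * (1 - (p⁻¹).toReal)) * schattenNorm p M ^ γ := by
    have h1 := sum_le_card_rpow_mul_norm hp hs
    rw [← hrank, ← hMn p hp] at h1
    refine (Real.rpow_le_rpow (sum_nonneg fun b _ => hs b) h1 hγ0.le).trans (le_of_eq ?_)
    rw [Real.mul_rpow (Real.rpow_nonneg (Nat.cast_nonneg _) _) hM0,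
      ← Real.rpow_mul (Nat.cast_nonneg _), mul_comm γ]
  have hn1 : (0 : ℝ) ≤ (n : ℝ) - 1 := by
    have : (1 : ℝ) ≤ n := by exact_mod_cast hn
    linarith
  have := mul_le_mul_of_nonneg_left hr hn1
  linarith

/-! ### The equality case. -/

theorem norm_toLp_indicator {ι : Type*} [Fintype ι] [DecidableEq ι] {p : ENNReal} (hp : 1 ≤ p)
    {T : Finset ι} (hT : T.Nonempty) :
    ‖(WithLp.toLp p (fun i => if i ∈ T then 1 else 0) : PiLp p fun _ : ι => ℝ)‖ =
      (#T : ℝ) ^ (p⁻¹).toReal := by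
  have h0 : ∀ i, (0 : ℝ) ≤ if i ∈ T then 1 else 0 := fun i => by split_ifs <;> simp
  rcases eq_or_ne p ⊤ with rfl | ht
  · simp only [ENNReal.inv_top, ENNReal.toReal_zero, Real.rpow_zero]
    refine le_antisymm ?_ ?_
    · rw [PiLp.norm_eq_ciSup]
      refine Real.iSup_le (fun i => ?_) zero_le_one
      by_cases h : i ∈ T <;> simp [h]
    · obtain ⟨i, hi⟩ := hT
      simpa [hi] using le_norm_toLp_top (fun i => if i ∈ T then (1 : ℝ) else 0) i
  · have hp0 : 0 < p.toReal := ENNReal.toReal_pos (by positivity) ht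
    rw [norm_toLp_eq_sum_rpow hp0 h0, ENNReal.toReal_inv, one_div]
    congr 1
    simp [hp0.ne', Real.zero_rpow, apply_ite (fun x : ℝ => x ^ p.toReal)]

theorem marginal_diagonal {n : ℕ} {d : Fin n → ℕ} (s : (∀ i, Fin (d i)) → ℝ) (i : Fin n) :
    marginal (Matrix.diagonal fun b => (s b : ℂ)) i =
      Matrix.diagonal fun a => (marginalSum s i a : ℂ) := by
  ext a b
  by_cases hab : a = b
  · subst hab
    rw [marginal_apply_self, Matrix.diagonal_apply_eq, marginalSum]
    push_cast
    exact sum_congr rfl fun b _ => Matrix.diagonal_apply_eq _ _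
  · rw [Matrix.diagonal_apply_ne _ hab]
    simp only [marginal, Matrix.of_apply]
    refine sum_eq_zero fun x hx => Matrix.diagonal_apply_ne _ fun h => hab ?_
    rw [← (mem_filter.1 hx).2, h]
    simp

/-- The witness is the diagonal projection onto `r` basis vectors that differ only in coordinate
`i₀`. Its marginal at `i₀` is a projection of rank `r`; every other marginal is `r` times a rank-one
projection, of norm `r` for all p. -/
theorem exists_sum_schattenNorm_marginal_rpow_eq {n : ℕ} {d : Fin n → ℕ} {r : ℕ}
    (hd : ∀ i, 1 ≤ d i) {i₀ : Fin n} (hr : r ≤ d i₀) :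
    ∃ M : TensorMatrix d, M.rank = r ∧
      ∀ (p : ENNReal) (γ : ℝ), 1 ≤ p → 1 ≤ γ →
        ∑ i, schattenNorm p (marginal M i) ^ γ =
          (1 + (r : ℝ) ^ (γ * (1 - (p⁻¹).toReal)) * ((n : ℝ) - 1)) * schattenNorm p M ^ γ := by
  let z : ∀ i, Fin (d i) := fun i => ⟨0, hd i⟩
  let e : Fin r ↪ ∀ i, Fin (d i) :=
    ⟨fun c => Function.update z i₀ (Fin.castLE hr c), fun c c' h =>
      Fin.castLE_injective hr (Function.update_injective z i₀ h)⟩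
  have hcoe : ∀ c, e c = Function.update z i₀ (Fin.castLE hr c) := fun _ => rfl
  let s : (∀ i, Fin (d i)) → ℝ := fun b => if b ∈ univ.map e then 1 else 0
  have hs : ∀ b, 0 ≤ s b := fun b => by simp only [s]; split_ifs <;> simp
  have hrank : (Matrix.diagonal fun b => (s b : ℂ) : TensorMatrix d).rank = r := by
    have := rank_eq_of_svd (one_mem (Matrix.unitaryGroup (∀ i, Fin (d i)) ℂ)) (one_mem _) s
    rw [Matrix.one_mul, Matrix.conjTranspose_one, Matrix.mul_one] at this
    rw [this]
    have h : ({b | s b ≠ 0} : Finset (∀ i, Fin (d i))) = univ.map e := by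
      ext b
      simp [s]
    rw [h, card_map, card_univ, Fintype.card_fin]
  have hmarg : ∀ i a, marginalSum s i a = ∑ c : Fin r, if e c i = a then 1 else 0 := fun i a => by
    simp only [marginalSum, s]
    rw [← sum_filter, filter_filter, ← sum_filter]
    have h : ({b | b i = a ∧ b ∈ univ.map e} : Finset (∀ i, Fin (d i))) =
        ({c | e c i = a} : Finset (Fin r)).map e := by
      ext b
      simp only [mem_filter, mem_univ, true_and, mem_map]
      constructor
      · rintro ⟨h, c, rfl⟩
        exact ⟨c, h, rfl⟩
      · rintro ⟨c, h, rfl⟩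
        exact ⟨h, c, rfl⟩
    rw [h, sum_map]
  refine ⟨Matrix.diagonal fun b => (s b : ℂ), hrank, fun p γ hp hγ => ?_⟩
  have hγ0 : 0 < γ := by linarith
  simp_rw [marginal_diagonal, schattenNorm_diagonal hp (marginalSum_nonneg hs _),
    schattenNorm_diagonal hp hs]
  have hother : ∀ i, i ≠ i₀ →
      ‖(WithLp.toLp p (marginalSum s i) : PiLp p fun _ : Fin (d i) => ℝ)‖ = r := fun i hi => by
    have : Fact (1 ≤ p) := ⟨hp⟩
    have h : (WithLp.toLp p (marginalSum s i) : PiLp p fun _ : Fin (d i) => ℝ) =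
        PiLp.single p (z i) (r : ℝ) := by
      ext a
      have hz : ∀ c, e c i = z i := fun c => by
        rw [hcoe, Function.update_of_ne hi]
      simp [hmarg, hz, eq_comm]
    rw [h, PiLp.norm_single, Real.norm_of_nonneg (Nat.cast_nonneg r)]
  -- The case r = 0 is separate: at p = ∞ the formula r ^ (1/p) would read 0 ^ 0 = 1, while the norm
  -- is 0.
  rcases Nat.eq_zero_or_pos r with rfl | hr0
  · have hz : ∀ (ι : Type) [Fintype ι], ‖(WithLp.toLp p (fun _ => 0) : PiLp p fun _ : ι => ℝ)‖ = 0 :=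
      fun ι _ => le_antisymm (by simpa using norm_toLp_le_sum hp (f := fun _ : ι => 0) (by simp))
        (by have : Fact (1 ≤ p) := ⟨hp⟩; exact norm_nonneg _)
    have h1 : ∀ i, marginalSum s i = fun _ => 0 := fun i => by
      ext a
      simp [hmarg]
    have h2 : s = fun _ => 0 := by
      ext b
      simp [s]
    simp only [h1, hz, Real.zero_rpow hγ0.ne', sum_const_zero]
    simp [h2, hz, Real.zero_rpow hγ0.ne']
  · have : Nonempty (Fin r) := ⟨⟨0, hr0⟩⟩
    have hs' : ‖(WithLp.toLp p s : PiLp p fun _ : ∀ i, Fin (d i) => ℝ)‖ =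
        (r : ℝ) ^ (p⁻¹).toReal := by
      refine (norm_toLp_indicator hp (univ_nonempty.map)).trans ?_
      rw [card_map, card_univ, Fintype.card_fin]
    have hself : ‖(WithLp.toLp p (marginalSum s i₀) : PiLp p fun _ : Fin (d i₀) => ℝ)‖ =
        (r : ℝ) ^ (p⁻¹).toReal := by
      have h : marginalSum s i₀ = fun a => if a ∈ univ.map (Fin.castLEEmb hr) then 1 else 0 := by
        ext a
        have he : ∀ c, e c i₀ = Fin.castLE hr c := fun c => by
          rw [hcoe, Function.update_self]
        simp only [hmarg, he]
        split_ifs with ha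
        · obtain ⟨c, -, rfl⟩ := mem_map.1 ha
          simp
        · refine sum_eq_zero fun c _ => if_neg fun hc => ha ?_
          exact mem_map.2 ⟨c, mem_univ c, hc⟩
      rw [h]
      refine (norm_toLp_indicator hp (univ_nonempty.map)).trans ?_
      rw [card_map, card_univ, Fintype.card_fin]
    have hrpos : (0 : ℝ) < r := by exact_mod_cast hr0
    rw [← add_sum_erase _ _ (mem_univ i₀), hself, hs',
      sum_congr rfl fun i hi => by rw [hother i (ne_of_mem_erase hi)],
      sum_const, card_erase_of_mem (mem_univ _), card_univ, Fintype.card_fin, nsmul_eq_mul,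
      Nat.cast_sub i₀.pos, Nat.cast_one, add_mul, one_mul]
    congr 1
    -- The exponents combine as γ (1 - 1/p) + γ/p = γ.
    rw [mul_right_comm, ← Real.rpow_mul hrpos.le, ← Real.rpow_add hrpos, mul_comm]
    congr 2
    ring

theorem mainTheorem9 (n : ℕ) (d : Fin n → ℕ) (r : ℕ) :
    (∀ M : TensorMatrix d, M.rank = r →
      ∀ (p : ENNReal) (γ : ℝ), 1 ≤ p → 1 ≤ γ →
        ∑ i, schattenNorm p (marginal M i) ^ γ ≤
          (1 + (r : ℝ) ^ (γ * (1 - (p⁻¹).toReal)) * ((n : ℝ) - 1)) * schattenNorm p M ^ γ) ∧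
    ((∀ i, 1 ≤ d i) → (∃ i, r ≤ d i) →
      ∃ M : TensorMatrix d, M.rank = r ∧
        ∀ (p : ENNReal) (γ : ℝ), 1 ≤ p → 1 ≤ γ →
          ∑ i, schattenNorm p (marginal M i) ^ γ =
            (1 + (r : ℝ) ^ (γ * (1 - (p⁻¹).toReal)) * ((n : ℝ) - 1)) * schattenNorm p M ^ γ) := by
  refine ⟨fun M hM p γ hp hγ => ?_, fun hd ⟨i, hi⟩ =>
    exists_sum_schattenNorm_marginal_rpow_eq hd hi⟩
  subst hM
  exact sum_schattenNorm_marginal_rpow_le M hp hγ
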